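/- Let $\Gamma$ be a torsion-free abelian group and let $D=\bigoplus_{\gamma\in\Gamma}D_\gamma$ be a graded division algebra with centre $F$; that is, $D\neq 0$ is a $\Gamma$-graded ring in which every nonzero homogeneous element is invertible, and $D$ is finite-dimensional (as a free module) over its centre $F$. Assume that $F$ is Noetherian as a ring. Then $[D:F]=n^2$ for a natural number $n$, the index of $D$. A graded subfield of $D$ is a commutative graded subring $L$ with $F\subseteq L\subseteq D$ in which every nonzero homogeneous element has an inverse in $L$. Graded maximal subfields of $D$ exist, and every graded maximal subfield $L$ splits $D$: there are $m\in\mathbb N$, $(\delta_1,\dots,\delta_m)\in\Gamma^m$ and an isomorphism of graded $L$-algebras $j: L\otimes_F D\to M_m(L)(\delta_1,\dots,\delta_m)$, where the component of degree $\lambda$ of the right-hand side consists of the matrices whose $(i,k)$-entry lies in $L_{\delta_i+\lambda-\delta_k}$. For every such $L$ and $j$, the reduced trace $\mathrm{Trd}_D(a)=\mathrm{trace}(j(1\otimes a))\in L\subseteq D$ satisfies, for every $a\in D$, $$\mathrm{Trd}_D(a)=na+d_a\quad\text{for some } d_a\in[D,D],$$ where $[D,D]$ is the $F$-submodule of $D$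 generated by all $xy-yx$ with $x,y\in D$ homogeneous. -/

import Mathlib

open scoped TensorProduct

/-- A ring `D` graded by `𝒟` is a graded division ring: it is nonzero and every nonzero
homogeneous element is invertible. -/
structure IsGradedDivisionRing {Γ D : Type*} [Ring D] (𝒟 : Γ → AddSubgroup D) : Prop where
  nontrivial : Nontrivial D
  isUnit_of_mem : ∀ (γ : Γ) (x : D), x ∈ 𝒟 γ → x ≠ 0 → IsUnit x

/-- A graded division algebra (over its centre `F`): a graded division ring `D` with
`[D : F] < ∞`. -/
structure IsGradedDivisionAlgebra {Γ D : Type*} [Ring D] (𝒟 : Γ → AddSubgroup D) : Prop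
    extends IsGradedDivisionRing 𝒟 where
  finite : Module.Finite (Subring.center D) D

/-- The index of `D` over its centre `F`: the square root of the dimension `[D : F]`.
(For a graded division algebra `[D : F]` is a perfect square, so that nothing is rounded.) -/
noncomputable def gradedIndex (D : Type*) [Ring D] : ℕ :=
  Nat.sqrt (Module.finrank (Subring.center D) D)

/-- `[D, D]`: the `F`-submodule of `D` generated by the homogeneous additive commutators
`x * y - y * x`, where `F` is the centre of `D`. -/
def gradedCommutatorSubmodule {Γ D : Type*} [Ring D] (𝒟 : Γ → AddSubgroup D) :
    Submodule (Subring.center D) D :=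
  Submodule.span (Subring.center D)
    {z | ∃ (γ δ : Γ) (x y : D), x ∈ 𝒟 γ ∧ y ∈ 𝒟 δ ∧ z = x * y - y * x}

/-- `L` is a graded subfield of `D` containing the centre `F` of `D`: a commutative subalgebra
that contains the homogeneous components of each of its elements, and in which every nonzero
homogeneous element has an inverse. -/
structure IsGradedSubfield {Γ D : Type*} [AddCommGroup Γ] [DecidableEq Γ] [Ring D]
    (𝒟 : Γ → AddSubgroup D) [GradedRing 𝒟] (L : Subalgebra (Subring.center D) D) : Prop where
  mul_comm : ∀ x ∈ L, ∀ y ∈ L, x * y = y * x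
  component_mem : ∀ x ∈ L, ∀ γ : Γ, (DirectSum.decompose 𝒟 x γ : D) ∈ L
  exists_inv : ∀ (γ : Γ) (x : D), x ∈ L → x ∈ 𝒟 γ → x ≠ 0 → ∃ y ∈ L, x * y = 1

/-- `L` is a graded maximal subfield of `D`. -/
def IsGradedMaximalSubfield {Γ D : Type*} [AddCommGroup Γ] [DecidableEq Γ] [Ring D]
    (𝒟 : Γ → AddSubgroup D) [GradedRing 𝒟] (L : Subalgebra (Subring.center D) D) : Prop :=
  Maximal (IsGradedSubfield 𝒟) L

/-- A graded splitting of `D` by `L`: a graded isomorphism of `L`-algebras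
`j : L ⊗[F] D ≅ M_m(L)(d)` for some `m` and some `d = (d_1, …, d_m) ∈ Γ ^ m`. Here
`l ⊗ x` has degree `γ + δ` when `l ∈ L_γ = L ∩ D_γ` and `x ∈ D_δ`, and the component of degree `ε`
of `M_m(L)(d)` consists of the matrices whose `(i, k)` entry lies in `L` in degree
`d_i + ε - d_k`. -/
structure GradedSplitting {Γ D : Type*} [AddCommGroup Γ] [Ring D]
    (𝒟 : Γ → AddSubgroup D) (L : Subalgebra (Subring.center D) D) where
  /-- the size of the matrices -/
  size : ℕ
  /-- the shifts of the grading on the matrix ring -/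
  shift : Fin size → Γ
  /-- the isomorphism -/
  iso : (L ⊗[Subring.center D] D) ≃+* Matrix (Fin size) (Fin size) L
  /-- `iso` is linear over `L` -/
  map_smul : ∀ (l : L) (x : L ⊗[Subring.center D] D), iso (l • x) = l • iso x
  /-- `iso` preserves degrees -/
  map_mem : ∀ (γ δ : Γ) (l : L) (x : D), (l : D) ∈ 𝒟 γ → x ∈ 𝒟 δ →
    ∀ i k : Fin size, (iso (l ⊗ₜ x) i k : D) ∈ 𝒟 (shift i + (γ + δ) - shift k)

/-- The reduced trace of `a`, computed with a graded splitting `j : L ⊗[F] D ≅ M_m(L)(d)`: the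
trace of the matrix `j (1 ⊗ a)`, seen in `D`. -/
noncomputable def GradedSplitting.reducedTrace {Γ D : Type*} [AddCommGroup Γ] [Ring D]
    {𝒟 : Γ → AddSubgroup D} {L : Subalgebra (Subring.center D) D}
    (S : GradedSplitting 𝒟 L) (a : D) : D :=
  ((S.iso (1 ⊗ₜ a)).trace : L)

/-! Let `L` be a graded maximal subfield. It is its own centralizer, and `L ⊗ D` acts on `D` by `x ↦
l * x * d`. A shortest-relation argument makes this action faithful (`sandwich_injective`), and a
graded density theorem (`exists_sandwich_eq_ite`) makes it surject onto the `L`-linear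
endomorphisms. Matrices in a homogeneous `L`-basis of `D` then give the splitting, and comparing
ranks gives `[D : F] = m ^ 2`.

For the trace formula the grading is needed only to know that `L` is free, hence faithfully flat,
over `F`. Automorphisms of matrix algebras preserve the trace (`Matrix.trace_algEquiv`), so by
descent `Trd a` lies in `F`. Therefore `Trd a - n * a` has reduced trace `n * Trd a - n * Trd a =
0`. Over `L`, a map that kills commutators is a multiple of the trace, so an element of reduced
trace zero vanishes in `L ⊗ D / [D, D]`, hence in `D / [D, D]` (`mem_of_trace_eq_zero`). -/

/-! ### Traces and automorphisms of matrix algebras over a commutative ring. -/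

namespace Matrix

variable {R N : Type*} [CommRing R] {m : ℕ}

/-- A linear map on matrices that vanishes on additive commutators is a multiple of the trace. -/
theorem apply_eq_trace_smul_of_map_mul_comm [AddCommGroup N] [Module R N]
    (f : Matrix (Fin m) (Fin m) R →ₗ[R] N) (hf : ∀ x y, f (x * y) = f (y * x))
    (i : Fin m) (y : Matrix (Fin m) (Fin m) R) : f y = y.trace • f (single i i 1) := by
  have hne : ∀ a b : Fin m, a ≠ b → f (single a b 1) = 0 := fun a b hab => by
    have h := hf (single a a 1) (single a b 1)
    simpa [single_mul_single_of_ne, hab.symm] using h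
  have heq : ∀ a : Fin m, f (single a a 1) = f (single i i 1) := fun a => by
    have h := hf (single a i 1) (single i a 1)
    simpa using h
  conv_lhs => rw [matrix_eq_sum_single y]
  have hs : ∀ a b : Fin m, single a b (y a b) = y a b • single a b (1 : R) := fun a b => by simp
  simp only [hs, map_sum, map_smul, trace, diag_apply, Finset.sum_smul]
  refine Finset.sum_congr rfl fun a _ => ?_
  rw [Finset.sum_eq_single a (fun b _ hb => by rw [hne a b hb.symm, smul_zero]) (by simp), heq]

/-- Automorphisms of matrix algebras preserve the trace. -/
theorem trace_algEquiv (φ : Matrix (Fin m) (Fin m) R ≃ₐ[R] Matrix (Fin m) (Fin m) R)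
    (x : Matrix (Fin m) (Fin m) R) : (φ x).trace = x.trace := by
  rcases isEmpty_or_nonempty (Fin m) with h | ⟨⟨i⟩⟩
  · simp [trace]
  have key (x) : (φ x).trace = x.trace * (φ (single i i 1)).trace := by
    have := apply_eq_trace_smul_of_map_mul_comm (traceLinearMap (Fin m) R R ∘ₗ φ.toLinearMap)
      (fun x y => by simp [trace_mul_comm (φ x)]) i x
    simpa using this
  -- By `key`, the trace after `φ` is `c` times the trace; the rest shows `c = 1`.
  set c := (φ (single i i 1)).trace with hc
  have hunit : IsUnit c := by
    refine IsUnit.of_mul_eq_one_right (φ.symm (single i i 1)).trace ?_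
    rw [← key]; simp
  set e : Fin m → Fin m → Matrix (Fin m) (Fin m) R := fun a b => φ (single a b 1) with he
  have hcorner (y : Matrix (Fin m) (Fin m) R) (a b : Fin m) :
      e a i * y * e i b = (φ.symm y) i i • e a b := by
    obtain ⟨z, rfl⟩ := φ.surjective y
    simp only [he, ← map_mul, ← map_smul, AlgEquiv.symm_apply_apply]
    congr 1
    ext p q
    simp only [mul_apply, single, of_apply, ite_and, smul_apply, smul_eq_mul, ite_mul, one_mul,
      zero_mul, Finset.sum_ite_eq, Finset.mem_univ, if_true, mul_ite, mul_one, mul_zero,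
      Finset.sum_ite_irrel, Finset.sum_const_zero]
    split_ifs <;> simp
  have htr (y) : (e i i * y).trace = (φ.symm y) i i * c := by
    have h := congrArg trace (hcorner y i i)
    rw [mul_assoc, trace_mul_comm, mul_assoc, trace_smul, smul_eq_mul] at h
    have hidem : e i i * e i i = e i i := by simp [he, ← map_mul]
    rw [trace_mul_comm, ← h, hidem]
  have hlam (a b) : e i i b a = (φ.symm (single a b 1)) i i * c := by
    rw [← htr, trace_mul_single]; simp
  -- The corner `e i i * E_ab * e i i` is a scalar multiple of `e i i`, and by `hlam` that scalar
  -- times `c` is an entry of `e i i`. On the diagonal this reads `c * t ^ 2 = t ^ 2`.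
  have hprod (p a b q) : c * (e i i p a * e i i b q) = e i i b a * e i i p q := by
    have h := congrFun (congrFun (hcorner (single a b 1) i i) p) q
    rw [Matrix.smul_apply, smul_eq_mul] at h
    rw [hlam a b, mul_right_comm, ← h]
    rw [mul_comm c]
    congr 1
    simp [Matrix.mul_apply, single, ite_and]
  have hsq (b) : (1 - c) * (e i i b b) ^ 2 = 0 := by
    linear_combination - hprod b b b b
  -- The diagonal entries of `e i i` sum to the unit `c`, so they and also their squares generate
  -- the unit ideal; `1 - c` kills all these squares.
  have hspan : Ideal.span (Set.range fun b => (e i i b b) ^ 2) = ⊤ := by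
    have h1 : Ideal.span (Set.range fun b => e i i b b) = ⊤ := by
      rw [Ideal.eq_top_iff_one]
      refine (Ideal.eq_top_iff_one _).1 (Ideal.eq_top_of_isUnit_mem _ ?_ hunit)
      rw [hc, trace]
      exact Ideal.sum_mem _ fun b _ => Ideal.subset_span ⟨b, rfl⟩
    have h2 := Ideal.span_pow_eq_top _ h1 2
    rwa [← Set.range_comp] at h2
  have h1c : 1 - c = 0 := by
    have h1 : (1 : R) ∈ Ideal.span (Set.range fun b => (e i i b b) ^ 2) := hspan ▸ trivial
    have : ∀ z ∈ Ideal.span (Set.range fun b => (e i i b b) ^ 2), (1 - c) * z = 0 := fun z hz => by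
      induction hz using Submodule.span_induction with
      | mem z hz => obtain ⟨b, rfl⟩ := hz; exact hsq b
      | zero => simp
      | add u v _ _ hu hv => rw [mul_add, hu, hv, add_zero]
      | smul r u _ hu => rw [smul_eq_mul, mul_left_comm, hu, mul_zero]
    simpa using this 1 h1
  rw [key x, ← sub_eq_zero.1 h1c, mul_one]

end Matrix

/-! ### Faithfully flat descent of the reduced trace. -/

section Splitting

variable {F L D : Type*} [CommRing F] [CommRing L] [Algebra F L] [Ring D] [Algebra F D] {m : ℕ}

theorem exists_algEquiv_cancelBaseChange (F L D R : Type*) [CommRing F] [CommRing L] [Algebra F L]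
    [Ring D] [Algebra F D] [CommRing R] [Algebra F R] [Algebra L R] [IsScalarTower F L R] :
    ∃ e : R ⊗[F] D ≃ₐ[R] R ⊗[L] (L ⊗[F] D), ∀ d, e (1 ⊗ₜ d) = 1 ⊗ₜ (1 ⊗ₜ d) := by
  let c := (TensorProduct.AlgebraTensorModule.cancelBaseChange F L R R D).symm
  have hc : ∀ r d, c (r ⊗ₜ d) = r ⊗ₜ (1 ⊗ₜ d) := fun _ _ => rfl
  refine ⟨AlgEquiv.ofLinearEquiv c (hc 1 1)
    (LinearMap.map_mul_of_map_mul_tmul fun _ _ _ _ => ?_), fun d => hc 1 d⟩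
  simp [hc]

/-- Base change of a splitting. -/
theorem exists_algEquiv_matrix_baseChange (j : L ⊗[F] D ≃ₐ[L] Matrix (Fin m) (Fin m) L)
    {R : Type*} [CommRing R] [Algebra F R] (f : L →ₐ[F] R) :
    ∃ e : R ⊗[F] D ≃ₐ[R] Matrix (Fin m) (Fin m) R, ∀ d, e (1 ⊗ₜ d) = (j (1 ⊗ₜ d)).map f := by
  let _ := f.toRingHom.toAlgebra
  have : IsScalarTower F L R := IsScalarTower.of_algebraMap_eq fun x => (f.commutes x).symm
  obtain ⟨e₁, h₁⟩ := exists_algEquiv_cancelBaseChange F L D R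
  let e₂ : R ⊗[L] (L ⊗[F] D) ≃ₐ[R] R ⊗[L] Matrix (Fin m) (Fin m) L :=
    Algebra.TensorProduct.congr AlgEquiv.refl j
  let e₃ : R ⊗[L] Matrix (Fin m) (Fin m) L ≃ₐ[R] Matrix (Fin m) (Fin m) R :=
    AlgEquiv.ofRingEquiv (f := (matrixEquivTensor (Fin m) L R).symm.toRingEquiv) (fun r => by
      change r • (1 : Matrix (Fin m) (Fin m) L).map (algebraMap L R) = _
      rw [Matrix.map_one _ (map_zero _) (map_one _), Algebra.algebraMap_eq_smul_one])
  refine ⟨(e₁.trans e₂).trans e₃, fun d => ?_⟩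
  rw [AlgEquiv.trans_apply, AlgEquiv.trans_apply, h₁]
  exact one_smul R ((j (1 ⊗ₜ d)).map f)

/-- Tensoring `L → L / F` with `L` sends `t ⊗ 1` to zero, hence also `1 ⊗ t`; by faithful flatness
`t` is zero in `L / F`. -/
theorem exists_algebraMap_eq_of_tmul_one_eq [Module.FaithfullyFlat F L] {t : L}
    (ht : t ⊗ₜ[F] (1 : L) = 1 ⊗ₜ[F] t) : ∃ r : F, algebraMap F L r = t := by
  let q := (LinearMap.range (Algebra.linearMap F L)).mkQ
  have h := congrArg (q.lTensor L) ht
  have h1 : q 1 = 0 := by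
    rw [Submodule.mkQ_apply, Submodule.Quotient.mk_eq_zero]
    exact ⟨1, by simp⟩
  rw [LinearMap.lTensor_tmul, LinearMap.lTensor_tmul, h1, TensorProduct.tmul_zero] at h
  have h2 : q t = 0 := by
    apply Module.FaithfullyFlat.tensorProduct_mk_injective (A := F) (B := L)
    simpa using h.symm
  rw [Submodule.mkQ_apply, Submodule.Quotient.mk_eq_zero] at h2
  simpa using h2

/-- The reduced trace has values in the base ring. -/
theorem exists_algebraMap_eq_trace [Module.FaithfullyFlat F L]
    (j : L ⊗[F] D ≃ₐ[L] Matrix (Fin m) (Fin m) L) (a : D) :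
    ∃ r : F, algebraMap F L r = (j (1 ⊗ₜ a)).trace := by
  apply exists_algebraMap_eq_of_tmul_one_eq
  -- The two inclusions of `L` in `L ⊗ L` give two splittings over `L ⊗ L`. They differ by an
  -- automorphism of the matrix algebra, so their traces agree.
  obtain ⟨e₁, h₁⟩ := exists_algEquiv_matrix_baseChange j
    (Algebra.TensorProduct.includeLeft : L →ₐ[F] L ⊗[F] L)
  obtain ⟨e₂, h₂⟩ := exists_algEquiv_matrix_baseChange j
    (Algebra.TensorProduct.includeRight : L →ₐ[F] L ⊗[F] L)
  have h := Matrix.trace_algEquiv (e₁.symm.trans e₂) (e₁ (1 ⊗ₜ a))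
  rw [AlgEquiv.trans_apply, AlgEquiv.symm_apply_apply, h₁, h₂] at h
  rw [← AddMonoidHom.map_trace, ← AddMonoidHom.map_trace] at h
  simpa using h.symm

/-- An element of reduced trace zero lies in every submodule that contains the additive
commutators. -/
theorem mem_of_trace_eq_zero [Module.FaithfullyFlat F L]
    (j : L ⊗[F] D ≃ₐ[L] Matrix (Fin m) (Fin m) L) (C : Submodule F D)
    (hC : ∀ x y : D, x * y - y * x ∈ C) {x : D} (hx : (j (1 ⊗ₜ x)).trace = 0) : x ∈ C := by
  let g : L ⊗[F] D →ₗ[L] L ⊗[F] (D ⧸ C) := C.mkQ.baseChange L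
  have hg : ∀ z w, g (z * w) = g (w * z) := fun z w => by
    induction z with
    | zero => simp
    | add u v hu hv => rw [add_mul, mul_add, map_add, map_add, hu, hv]
    | tmul l d =>
      induction w with
      | zero => simp
      | add u v hu hv => rw [add_mul, mul_add, map_add, map_add, hu, hv]
      | tmul l' d' =>
        have : C.mkQ (d * d') = C.mkQ (d' * d) := (Submodule.Quotient.eq C).2 (hC d d')
        simp only [g, Algebra.TensorProduct.tmul_mul_tmul, LinearMap.baseChange_tmul, this,
          mul_comm l l']
  have h0 : g (1 ⊗ₜ x) = 0 := by
    rcases isEmpty_or_nonempty (Fin m) with h | ⟨⟨i⟩⟩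
    · have : (1 : L) ⊗ₜ[F] x = 0 := j.injective (Subsingleton.elim _ _)
      rw [this, map_zero]
    · have := Matrix.apply_eq_trace_smul_of_map_mul_comm (g ∘ₗ j.symm.toLinearMap)
        (fun x y => by simp [hg (j.symm x)]) i (j (1 ⊗ₜ x))
      simpa [hx] using this
  have h1 : C.mkQ x = 0 := by
    apply Module.FaithfullyFlat.tensorProduct_mk_injective (A := F) (B := L)
    simpa [g] using h0
  simpa using h1

/-- The reduced trace of `a` is `m * a` up to additive commutators. -/
theorem exists_trace_eq_mul_add [Module.FaithfullyFlat F L]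
    (j : L ⊗[F] D ≃ₐ[L] Matrix (Fin m) (Fin m) L) (C : Submodule F D)
    (hC : ∀ x y : D, x * y - y * x ∈ C) (a : D) :
    ∃ r : F, algebraMap F L r = (j (1 ⊗ₜ a)).trace ∧ ∃ d ∈ C, algebraMap F D r = m * a + d := by
  obtain ⟨r, hr⟩ := exists_algebraMap_eq_trace j a
  refine ⟨r, hr, algebraMap F D r - m * a, mem_of_trace_eq_zero j C hC ?_, by abel⟩
  have h1 : (1 : L) ⊗ₜ[F] algebraMap F D r = algebraMap F L r • (1 : L ⊗[F] D) := by
    rw [Algebra.algebraMap_eq_smul_one, TensorProduct.tmul_smul, algebraMap_smul]; rfl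
  have h2 : (1 : L) ⊗ₜ[F] ((m : D) * a) = (m : L) • ((1 : L) ⊗ₜ[F] a) := by
    rw [← nsmul_eq_mul, TensorProduct.tmul_smul, Nat.cast_smul_eq_nsmul]
  rw [TensorProduct.tmul_sub, h1, h2, map_sub, map_smul, map_smul, map_one, Matrix.trace_sub,
    Matrix.trace_smul, Matrix.trace_smul, Matrix.trace_one, ← hr]
  simp [mul_comm]

end Splitting

/-! ### Homogeneous components and centralizers. -/

section Graded

open DirectSum

variable {Γ D : Type*} [AddCommGroup Γ] [DecidableEq Γ] [Ring D]
  (𝒟 : Γ → AddSubgroup D) [GradedRing 𝒟]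

theorem exists_decompose_ne_zero {x : D} (hx : x ≠ 0) : ∃ γ, (decompose 𝒟 x γ : D) ≠ 0 := by
  by_contra! h
  refine hx ((decompose 𝒟).injective ?_)
  rw [decompose_zero]
  exact DFinsupp.ext fun γ => Subtype.ext (h γ)

theorem decompose_mul_apply_eq_sum [∀ (i) (x : 𝒟 i), Decidable (x ≠ 0)] (x y : D) (γ : Γ) :
    (decompose 𝒟 (x * y) γ : D) =
      ∑ δ ∈ (decompose 𝒟 x).support, (decompose 𝒟 x δ : D) * decompose 𝒟 y (γ - δ) := by
  conv_lhs => rw [← sum_support_decompose 𝒟 x, Finset.sum_mul]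
  rw [← GradedRing.proj_apply, map_sum]
  refine Finset.sum_congr rfl fun δ _ => ?_
  rw [GradedRing.proj_apply]
  conv_lhs => rw [← add_sub_cancel δ γ]
  exact coe_decompose_mul_add_of_left_mem 𝒟 (SetLike.coe_mem _)

theorem component_mem_centralizer {S : Set D}
    (hS : ∀ x ∈ S, ∀ γ, (decompose 𝒟 x γ : D) ∈ S) {x : D} (hx : x ∈ S.centralizer) (γ : Γ) :
    (decompose 𝒟 x γ : D) ∈ S.centralizer := by
  classical
  intro y hy
  rw [← sum_support_decompose 𝒟 y, Finset.mul_sum, Finset.sum_mul]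
  refine Finset.sum_congr rfl fun δ _ => ?_
  have h := congrArg (fun z => (decompose 𝒟 z (γ + δ) : D)) (hx _ (hS y hy δ))
  simp only [coe_decompose_mul_add_of_right_mem 𝒟 (SetLike.coe_mem _)] at h
  rw [← h, add_comm γ δ, coe_decompose_mul_add_of_left_mem 𝒟 (SetLike.coe_mem _)]

theorem component_mem_center {x : D} (hx : x ∈ Subring.center D) (γ : Γ) :
    (decompose 𝒟 x γ : D) ∈ Subring.center D := by
  rw [Subring.mem_center_iff] at hx ⊢
  intro g
  exact component_mem_centralizer 𝒟 (S := Set.univ) (fun _ _ _ => trivial) (fun y _ => hx y) γ g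
    trivial

theorem mem_center_of_forall_homogeneous {c : D} (hc : ∀ γ, ∀ u ∈ 𝒟 γ, u * c = c * u) :
    c ∈ Subring.center D := by
  classical
  rw [Subring.mem_center_iff]
  intro y
  rw [← sum_support_decompose 𝒟 y, Finset.mul_sum, Finset.sum_mul]
  exact Finset.sum_congr rfl fun δ _ => hc δ _ (SetLike.coe_mem _)

/-! ### Homogeneous bases, over a ring `K` that stands for the centre or for a graded subfield. -/

section HomogeneousBasis

variable {K : Type*} [Ring K] [Module K D] (f : K →+* D) (hf : ∀ (r : K) (x : D), r • x = f r * x)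
  (hcomp : ∀ (r : K) (γ : Γ), ∃ r', f r' = decompose 𝒟 (f r) γ)

include hf hcomp in
theorem decompose_mem_span {s : Set D} (hs : ∀ x ∈ s, ∃ γ, x ∈ 𝒟 γ) {x : D}
    (hx : x ∈ Submodule.span K s) (γ : Γ) : (decompose 𝒟 x γ : D) ∈ Submodule.span K s := by
  classical
  induction hx using Submodule.span_induction generalizing γ with
  | mem x hx =>
    obtain ⟨δ, hδ⟩ := hs x hx
    by_cases h : δ = γ
    · subst h
      rw [decompose_of_mem_same 𝒟 hδ]
      exact Submodule.subset_span hx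
    · rw [decompose_of_mem_ne 𝒟 hδ h]
      exact zero_mem _
  | zero => simp
  | add x y _ _ hx hy => rw [decompose_add]; exact add_mem (hx γ) (hy γ)
  | smul r x _ hx =>
    rw [hf, decompose_mul_apply_eq_sum]
    refine sum_mem fun δ _ => ?_
    obtain ⟨r', hr'⟩ := hcomp r δ
    rw [← hr', ← hf]
    exact Submodule.smul_mem _ _ (hx _)

include hf hcomp in
/-- Graded vector spaces over graded fields have homogeneous bases. -/
theorem exists_homogeneous_basis (hinj : Function.Injective f)
    (hunit : ∀ (r : K) (γ : Γ), f r ∈ 𝒟 γ → r ≠ 0 → IsUnit r)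
    (V : Submodule K D) (hV : ∀ x ∈ V, ∀ γ, (decompose 𝒟 x γ : D) ∈ V) :
    ∃ s : Set D, (∀ x ∈ s, ∃ γ, x ∈ 𝒟 γ) ∧ LinearIndepOn K id s ∧ Submodule.span K s = V := by
  classical
  let v : {x : D // x ∈ V ∧ ∃ γ, x ∈ 𝒟 γ} → D := Subtype.val
  obtain ⟨s, hli, hmax⟩ := exists_maximal_linearIndepOn K v
  have hs : ∀ x ∈ v '' s, ∃ γ, x ∈ 𝒟 γ := by
    rintro _ ⟨y, _, rfl⟩
    exact y.2.2
  refine ⟨v '' s, hs, hli.id_image, le_antisymm ?_ ?_⟩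
  · rw [Submodule.span_le]
    rintro _ ⟨y, _, rfl⟩
    exact y.2.1
  have hmem : ∀ i, v i ∈ Submodule.span K (v '' s) := by
    intro i
    by_cases hi : i ∈ s
    · exact Submodule.subset_span ⟨i, hi, rfl⟩
    -- Maximality puts only a nonzero multiple `a • v i` in the span. A nonzero homogeneous
    -- component of `a` is a unit and can be divided out.
    obtain ⟨a, ha, hai⟩ := hmax i hi
    obtain ⟨δ, hδ⟩ := i.2.2
    have hfa : f a ≠ 0 := fun h => ha (hinj (h.trans (map_zero f).symm))
    obtain ⟨γ, hγ⟩ := exists_decompose_ne_zero 𝒟 hfa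
    have h := decompose_mem_span 𝒟 f hf hcomp hs hai (γ + δ)
    obtain ⟨r, hr⟩ := hcomp a γ
    rw [hf, coe_decompose_mul_add_of_right_mem 𝒟 hδ, ← hr, ← hf] at h
    refine (Submodule.smul_mem_iff_of_isUnit _ (hunit r γ ?_ ?_)).1 h
    · rw [hr]; exact SetLike.coe_mem _
    · rintro rfl
      exact hγ (by rw [← hr, map_zero])
  intro x hx
  rw [← sum_support_decompose 𝒟 x]
  exact sum_mem fun γ _ => hmem ⟨_, hV x hx γ, γ, SetLike.coe_mem _⟩

-- Cutting each coefficient down to its component of degree `γ - β i` still represents `y`, so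
-- uniqueness of coordinates applies.
include hf hcomp in
theorem repr_mem_of_mem {ι : Type*} [Fintype ι] (b : Module.Basis ι K D) {β : ι → Γ}
    (hb : ∀ i, b i ∈ 𝒟 (β i)) {y : D} {γ : Γ} (hy : y ∈ 𝒟 γ) (k : ι) :
    f (b.repr y k) ∈ 𝒟 (γ - β k) := by
  choose r hr using fun i => hcomp (b.repr y i) (γ - β i)
  have h : ∑ i, r i • b i = y := by
    have h1 : (decompose 𝒟 y γ : D) = y := decompose_of_mem_same 𝒟 hy
    conv_rhs => rw [← h1, ← b.sum_repr y, ← GradedRing.proj_apply, map_sum]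
    refine Finset.sum_congr rfl fun i _ => ?_
    rw [GradedRing.proj_apply, hf, hf, hr]
    conv_rhs => rw [← sub_add_cancel γ (β i)]
    exact (coe_decompose_mul_add_of_right_mem 𝒟 (hb i)).symm
  have h2 : b.repr y k = r k := by
    rw [← h, b.repr_sum_self]
  rw [h2, hr]
  exact SetLike.coe_mem _

end HomogeneousBasis

/-! ### The sandwich action: density and faithfulness. -/

/-- The sandwich action `x ↦ l * x * d` of `L ⊗ D` on `D`. -/
def sandwich {F : Type*} [CommRing F] [Algebra F D] (L : Subalgebra F D) :
    L ⊗[F] D →ₗ[F] Module.End F D :=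
  TensorProduct.lift (LinearMap.mk₂ F
    (fun l d => LinearMap.mulLeft F (l : D) ∘ₗ LinearMap.mulRight F d)
    (fun _ _ _ => LinearMap.ext fun _ => by simp [add_mul])
    (fun _ _ _ => LinearMap.ext fun _ => by simp)
    (fun _ _ _ => LinearMap.ext fun _ => by simp [mul_add])
    (fun _ _ _ => LinearMap.ext fun _ => by simp))

section Sandwich

variable {F : Type*} [CommRing F] [Algebra F D] (L : Subalgebra F D)

theorem sandwich_tmul (l : L) (d x : D) : sandwich L (l ⊗ₜ d) x = l * (x * d) := rfl

theorem sandwich_mul_one_tmul (z : L ⊗[F] D) (d x : D) :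
    sandwich L (z * (1 ⊗ₜ d)) x = sandwich L z x * d := by
  induction z with
  | zero => simp
  | add z w hz hw => simp only [add_mul, map_add, LinearMap.add_apply, hz, hw]
  | tmul l e => simp [sandwich_tmul, mul_assoc]

theorem sandwich_smul (l : L) (z : L ⊗[F] D) (x : D) :
    sandwich L (l • z) x = l * sandwich L z x := by
  induction z with
  | zero => simp
  | add z w hz hw => simp only [smul_add, mul_add, map_add, LinearMap.add_apply, hz, hw]
  | tmul l' e => simp [TensorProduct.smul_tmul', sandwich_tmul, mul_assoc]

variable {L}

theorem sandwich_mul_left (hL : ∀ x ∈ L, ∀ y ∈ L, x * y = y * x) (l : L) (z : L ⊗[F] D) (x : D) :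
    sandwich L z (l * x) = l * sandwich L z x := by
  induction z with
  | zero => simp
  | add z w hz hw => simp only [mul_add, map_add, LinearMap.add_apply, hz, hw]
  | tmul l' e =>
    simp only [sandwich_tmul, ← mul_assoc]
    rw [hL l' l'.2 l l.2]

/-- `D` acts on the right, so the order of composition is reversed; commutativity of `L` makes this
harmless for the left factor. -/
theorem sandwich_mul (hL : ∀ x ∈ L, ∀ y ∈ L, x * y = y * x) (z w : L ⊗[F] D) (x : D) :
    sandwich L (z * w) x = sandwich L w (sandwich L z x) := by
  induction w with
  | zero => simp
  | add u v hu hv => simp only [mul_add, map_add, LinearMap.add_apply, hu, hv]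
  | tmul l d =>
    have h : z * (l ⊗ₜ d) = l • (z * (1 ⊗ₜ d)) := by
      induction z with
      | zero => simp
      | add u v hu hv => simp only [add_mul, smul_add, hu, hv]
      | tmul l' d' =>
        simp only [Algebra.TensorProduct.tmul_mul_tmul, TensorProduct.smul_tmul', mul_one,
          smul_eq_mul]
        congr 1
        exact Subtype.ext (hL l' l'.2 l l.2)
    rw [h, sandwich_smul, sandwich_mul_one_tmul, sandwich_tmul]

theorem exists_sandwich_eq_component (hcomp : ∀ x ∈ L, ∀ γ, (decompose 𝒟 x γ : D) ∈ L)
    (z : L ⊗[F] D) (γ : Γ) :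
    ∃ w : L ⊗[F] D, ∀ β, ∀ b ∈ 𝒟 β,
      sandwich L w b = decompose 𝒟 (sandwich L z b) (γ + β) := by
  classical
  induction z with
  | zero => exact ⟨0, by simp⟩
  | add z w hz hw =>
    obtain ⟨z', hz⟩ := hz
    obtain ⟨w', hw⟩ := hw
    exact ⟨z' + w', fun β b hb => by simp [hz β b hb, hw β b hb, decompose_add]⟩
  | tmul l d =>
    refine ⟨∑ δ ∈ (decompose 𝒟 (l : D)).support,
      (⟨_, hcomp l l.2 δ⟩ : L) ⊗ₜ (decompose 𝒟 d (γ - δ) : D), fun β b hb => ?_⟩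
    rw [sandwich_tmul, decompose_mul_apply_eq_sum, map_sum, LinearMap.sum_apply]
    refine Finset.sum_congr rfl fun δ _ => ?_
    rw [sandwich_tmul]
    congr 1
    rw [show γ + β - δ = β + (γ - δ) by abel, coe_decompose_mul_add_of_left_mem 𝒟 hb]

/-- A graded density theorem. -/
theorem exists_sandwich_eq_ite [Nontrivial L] (hunit : ∀ γ, ∀ x ∈ 𝒟 γ, x ≠ 0 → IsUnit x)
    (hcomp : ∀ x ∈ L, ∀ γ, (decompose 𝒟 x γ : D) ∈ L)
    (hcent : ∀ c : D, (∀ l ∈ L, l * c = c * l) → c ∈ L)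
    {ι : Type*} [DecidableEq ι] (b : ι → D) (hb : ∀ i, ∃ γ, b i ∈ 𝒟 γ)
    (hli : LinearIndependent L b) (s : Finset ι) :
    ∀ i ∈ s, ∃ z : L ⊗[F] D, ∀ k ∈ s, sandwich L z (b k) = if k = i then 1 else 0 := by
  induction s using Finset.induction_on with
  | empty => simp
  | insert a s ha ih =>
    choose! t ht using ih
    -- Otherwise the values of `z` on the `b i` with `i ∈ s` determine its value on `b a`. The
    -- coefficients in that formula commute with `L`, so they lie in `L`, and `z = 1` contradicts
    -- linear independence.
    have hne : ∃ z : L ⊗[F] D, (∀ k ∈ s, sandwich L z (b k) = 0) ∧ sandwich L z (b a) ≠ 0 := by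
      by_contra! hcon
      have hz : ∀ z : L ⊗[F] D,
          sandwich L z (b a) = ∑ i ∈ s, sandwich L (t i) (b a) * sandwich L z (b i) := by
        intro z
        have h := hcon (z - ∑ i ∈ s, t i * (1 ⊗ₜ sandwich L z (b i))) fun k hk => by
          simp only [map_sub, map_sum, LinearMap.sub_apply, LinearMap.sum_apply,
            sandwich_mul_one_tmul]
          rw [Finset.sum_eq_single k, ht k hk k hk]
          · simp
          · intro i hi hik
            rw [ht i hi k hk, if_neg hik.symm, zero_mul]
          · exact fun h => absurd hk h
        simpa only [map_sub, map_sum, LinearMap.sub_apply, LinearMap.sum_apply,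
          sandwich_mul_one_tmul, sub_eq_zero] using h
      have hcL : ∀ i ∈ s, sandwich L (t i) (b a) ∈ L := fun i hi => hcent _ fun l hl => by
        have h := hz ((⟨l, hl⟩ : L) • t i)
        simp only [sandwich_smul] at h
        rw [h, Finset.sum_eq_single i]
        · rw [ht i hi i hi, if_pos rfl, mul_one]
        · intro k hk hki
          rw [ht i hi k hk, if_neg hki, mul_zero, mul_zero]
        · exact fun h => absurd hi h
      have h1 := hz (1 ⊗ₜ 1)
      simp only [sandwich_tmul, OneMemClass.coe_one, one_mul, mul_one] at h1
      refine hli.notMem_span_image (s := (s : Set ι)) (x := a) (by simpa using ha) ?_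
      rw [h1]
      exact sum_mem fun i hi => Submodule.smul_mem _ (⟨_, hcL i hi⟩ : L)
        (Submodule.subset_span ⟨i, hi, rfl⟩)
    obtain ⟨z₀, hz₀, hz₀a⟩ := hne
    obtain ⟨β, hβ⟩ := hb a
    obtain ⟨γ, hγ⟩ := exists_decompose_ne_zero 𝒟 hz₀a
    -- A homogeneous component of `z₀` still kills the other `b k`, and its value at `b a` is a
    -- unit, which can be normalised to `1`.
    obtain ⟨z₁, hz₁⟩ := exists_sandwich_eq_component 𝒟 hcomp z₀ (γ - β)
    have h1a := hz₁ β _ hβ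
    rw [sub_add_cancel] at h1a
    obtain ⟨u, hu⟩ := hunit γ _ (SetLike.coe_mem _) hγ
    have hza : sandwich L (z₁ * (1 ⊗ₜ (↑u⁻¹ : D))) (b a) = 1 := by
      rw [sandwich_mul_one_tmul, h1a, ← hu, Units.mul_inv]
    have hzs : ∀ k ∈ s, sandwich L (z₁ * (1 ⊗ₜ (↑u⁻¹ : D))) (b k) = 0 := fun k hk => by
      obtain ⟨δ, hδ⟩ := hb k
      rw [sandwich_mul_one_tmul, hz₁ δ _ hδ, hz₀ k hk, decompose_zero]
      simp
    generalize z₁ * (1 ⊗ₜ (↑u⁻¹ : D)) = z at hza hzs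
    intro i hi
    rcases Finset.mem_insert.1 hi with rfl | his
    · refine ⟨z, fun k hk => ?_⟩
      rcases Finset.mem_insert.1 hk with rfl | hks
      · rw [hza, if_pos rfl]
      · rw [hzs k hks, if_neg (ne_of_mem_of_not_mem hks ha)]
    · refine ⟨t i - z * (1 ⊗ₜ sandwich L (t i) (b a)), fun k hk => ?_⟩
      rw [map_sub, LinearMap.sub_apply, sandwich_mul_one_tmul]
      rcases Finset.mem_insert.1 hk with rfl | hks
      · rw [hza, one_mul, sub_self, if_neg (ne_of_mem_of_not_mem his ha).symm]
      · rw [hzs k hks, zero_mul, sub_zero, ht i his k hks]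

end Sandwich

theorem inv_mem_of_mem (u : Dˣ) {γ : Γ} (hu : (u : D) ∈ 𝒟 γ) : (↑u⁻¹ : D) ∈ 𝒟 (-γ) := by
  have h : (u : D) * decompose 𝒟 (↑u⁻¹ : D) (-γ) = 1 := by
    rw [← coe_decompose_mul_add_of_left_mem 𝒟 hu, Units.mul_inv, add_neg_cancel]
    exact decompose_of_mem_same 𝒟 SetLike.GradedOne.one_mem
  rw [Units.inv_eq_of_mul_eq_one_right h]
  exact SetLike.coe_mem _

/-- Shortest-relation argument: normalise one coefficient to `1` and take commutators with a
homogeneous `w`. The shorter relation so obtained forces the other coefficients to be central, and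
`x = 1` contradicts independence. -/
theorem eq_zero_of_forall_sum_mul_mul_eq_zero_of_homogeneous [Nontrivial D]
    (hunit : ∀ γ, ∀ x ∈ 𝒟 γ, x ≠ 0 → IsUnit x)
    {ι : Type*} {e : ι → D} (he : LinearIndependent (Subring.center D) e) (s : Finset ι) :
    ∀ d : ι → D, (∀ i, ∃ γ, d i ∈ 𝒟 γ) → (∀ x, ∑ i ∈ s, e i * (x * d i) = 0) →
      ∀ i ∈ s, d i = 0 := by
  classical
  induction s using Finset.induction_on with
  | empty => simp
  | insert a s ha ih =>
    intro d hd h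
    have hda : d a = 0 := by
      by_contra hne
      obtain ⟨γ, hγ⟩ := hd a
      obtain ⟨u, hu⟩ := hunit γ _ hγ hne
      have hsum : ∀ x, e a * x + ∑ i ∈ s, e i * (x * (d i * ↑u⁻¹)) = 0 := fun x => by
        have := congrArg (· * (↑u⁻¹ : D)) (h x)
        simpa [Finset.sum_insert ha, ← hu, add_mul, Finset.sum_mul, mul_assoc] using this
      have hcomm : ∀ i ∈ s, d i * ↑u⁻¹ ∈ Subring.center D := by
        intro i hi
        refine mem_center_of_forall_homogeneous 𝒟 fun μ w hw => sub_eq_zero.1 ?_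
        refine ih (fun i => w * (d i * ↑u⁻¹) - d i * ↑u⁻¹ * w) (fun k => ?_) (fun x => ?_) i hi
        · obtain ⟨δ, hδ⟩ := hd k
          have hv := SetLike.mul_mem_graded hδ (inv_mem_of_mem 𝒟 u (hu ▸ hγ))
          refine ⟨μ + (δ + -γ), sub_mem (SetLike.mul_mem_graded hw hv) ?_⟩
          rw [add_comm μ]
          exact SetLike.mul_mem_graded hv hw
        · have h1 := hsum (x * w)
          have h2 := congrArg (· * w) (hsum x)
          simp only [add_mul, zero_mul, Finset.sum_mul, mul_assoc] at h1 h2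
          have h3 := h1.trans h2.symm
          simpa [mul_sub, Finset.sum_sub_distrib, sub_eq_zero, mul_assoc] using h3
      have h1 := hsum 1
      simp only [one_mul, mul_one] at h1
      refine he.notMem_span_image (s := (s : Set ι)) (x := a) (by simpa using ha) ?_
      rw [eq_neg_of_add_eq_zero_left h1]
      refine neg_mem (sum_mem fun i hi => ?_)
      rw [Subring.mem_center_iff.1 (hcomm i hi)]
      exact Submodule.smul_mem _ (⟨_, hcomm i hi⟩ : Subring.center D)
        (Submodule.subset_span ⟨i, hi, rfl⟩)
    have h' : ∀ x, ∑ i ∈ s, e i * (x * d i) = 0 := fun x => by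
      have := h x
      rwa [Finset.sum_insert ha, hda, mul_zero, mul_zero, zero_add] at this
    intro i hi
    rcases Finset.mem_insert.1 hi with rfl | hi
    · exact hda
    · exact ih d hd h' i hi

theorem eq_zero_of_forall_sum_mul_mul_eq_zero [Nontrivial D]
    (hunit : ∀ γ, ∀ x ∈ 𝒟 γ, x ≠ 0 → IsUnit x)
    {ι : Type*} {e : ι → D} (he : LinearIndependent (Subring.center D) e)
    {ε : ι → Γ} (hε : ∀ i, e i ∈ 𝒟 (ε i)) (s : Finset ι) (d : ι → D)
    (h : ∀ x, ∑ i ∈ s, e i * (x * d i) = 0) : ∀ i ∈ s, d i = 0 := by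
  classical
  intro i hi
  by_contra hne
  obtain ⟨μ, hμ⟩ := exists_decompose_ne_zero 𝒟 hne
  refine hμ ?_
  -- The degrees are chosen so that all `e k * x * d k` have the same degree for homogeneous `x`,
  -- and index `i` picks out degree `μ` of `d i`.
  have := eq_zero_of_forall_sum_mul_mul_eq_zero_of_homogeneous 𝒟 hunit he s
    (fun k => (decompose 𝒟 (d k) (μ + ε i - ε k) : D)) (fun k => ⟨_, SetLike.coe_mem _⟩) ?_ i hi
  · rwa [show μ + ε i - ε i = μ from add_sub_cancel_right _ _] at this
  intro x
  rw [← sum_support_decompose 𝒟 x]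
  simp only [Finset.sum_mul, Finset.mul_sum]
  rw [Finset.sum_comm]
  refine Finset.sum_eq_zero fun η _ => ?_
  have h1 := congrArg (fun y => (decompose 𝒟 y (μ + ε i + η) : D)) (h (decompose 𝒟 x η : D))
  simp only [decompose_zero, ← GradedRing.proj_apply, map_sum] at h1
  refine Eq.trans (Finset.sum_congr rfl fun k _ => ?_) h1
  simp only [GradedRing.proj_apply, ← mul_assoc]
  rw [show μ + ε i + η = (ε k + η) + (μ + ε i - ε k) by abel,
    coe_decompose_mul_add_of_left_mem 𝒟 (SetLike.mul_mem_graded (hε k) (SetLike.coe_mem _))]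

end Graded

/-! ### Graded subfields and the graded splitting. -/

theorem isUnit_of_mem_center {Γ D : Type*} [Ring D] {𝒟 : Γ → AddSubgroup D}
    (hD : IsGradedDivisionRing 𝒟) (r : Subring.center D) (γ : Γ) (hr : (r : D) ∈ 𝒟 γ)
    (hne : r ≠ 0) : IsUnit r := by
  obtain ⟨u, hu⟩ := hD.isUnit_of_mem γ r hr (by simpa using hne)
  have hinv : (↑u⁻¹ : D) ∈ Subring.center D := by
    rw [Subring.mem_center_iff]
    intro y
    exact (show Commute y (u : D) from hu ▸ Subring.mem_center_iff.1 r.2 y).units_inv_right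
  exact IsUnit.of_mul_eq_one ⟨_, hinv⟩ (Subtype.ext (by simp [← hu]))

section GradedDivision

open DirectSum

variable {Γ D : Type*} [AddCommGroup Γ] [DecidableEq Γ] [Ring D]
  {𝒟 : Γ → AddSubgroup D} [GradedRing 𝒟]

/-- The double centralizer replaces the generated subfield: centralizers are automatically closed
under inverses and inherit homogeneous components. -/
theorem isGradedSubfield_centralizer_centralizer (hD : IsGradedDivisionRing 𝒟) {S : Set D}
    (hcomm : ∀ x ∈ S, ∀ y ∈ S, x * y = y * x) (hS : ∀ x ∈ S, ∀ γ, (decompose 𝒟 x γ : D) ∈ S) :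
    IsGradedSubfield 𝒟 (Subalgebra.centralizer (Subring.center D)
      (Subalgebra.centralizer (Subring.center D) S : Set D)) where
  mul_comm := fun x hx y hy => Set.centralizer_centralizer_comm_of_comm hcomm x hx y hy
  component_mem := fun x hx γ => component_mem_centralizer 𝒟
    (fun y hy δ => component_mem_centralizer 𝒟 hS hy δ) hx γ
  exists_inv := fun γ x hx hγ hne => by
    obtain ⟨u, rfl⟩ := hD.isUnit_of_mem γ x hγ hne
    refine ⟨↑u⁻¹, fun y hy => ?_, u.mul_inv⟩
    exact (show Commute y (u : D) from hx y hy).units_inv_right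

theorem isGradedSubfield_center (hD : IsGradedDivisionRing 𝒟) :
    ∃ L : Subalgebra (Subring.center D) D, IsGradedSubfield 𝒟 L :=
  ⟨_, isGradedSubfield_centralizer_centralizer hD (S := ∅) (by simp) (by simp)⟩

theorem exists_isGradedMaximalSubfield (hD : IsGradedDivisionAlgebra 𝒟)
    (hF : IsNoetherianRing (Subring.center D)) :
    ∃ L : Subalgebra (Subring.center D) D, IsGradedMaximalSubfield 𝒟 L := by
  have := hD.finite
  -- `D` is a finite module over the Noetherian ring `F`, so its submodules satisfy the ascending
  -- chain condition.
  have hwf : WellFoundedGT (Subalgebra (Subring.center D) D) :=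
    ⟨(InvImage.wf (fun L => Subalgebra.toSubmodule L)
      (wellFounded_gt (α := Submodule (Subring.center D) D))).mono fun _ _ h => h⟩
  exact exists_maximal_of_wellFoundedGT _ (isGradedSubfield_center hD.toIsGradedDivisionRing)

/-- A graded maximal subfield is its own centralizer. -/
theorem IsGradedMaximalSubfield.mem_of_commute {L : Subalgebra (Subring.center D) D}
    (hD : IsGradedDivisionRing 𝒟) (hL : IsGradedMaximalSubfield 𝒟 L) {c : D}
    (hc : ∀ l ∈ L, l * c = c * l) : c ∈ L := by
  classical
  have hhom : ∀ γ, (decompose 𝒟 c γ : D) ∈ L := by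
    intro γ
    have hcγ : ∀ l ∈ L, l * (decompose 𝒟 c γ : D) = decompose 𝒟 c γ * l :=
      component_mem_centralizer 𝒟 (S := (L : Set D)) hL.prop.component_mem hc γ
    have hmem : (decompose 𝒟 c γ : D) ∈ 𝒟 γ := SetLike.coe_mem _
    generalize (decompose 𝒟 c γ : D) = e at hcγ hmem
    -- Adjoining the homogeneous `e` to `L` and taking the double centralizer gives a graded
    -- subfield above `L`; maximality puts `e` in `L`.
    have hcomm : ∀ x ∈ insert e (L : Set D), ∀ y ∈ insert e (L : Set D), x * y = y * x := by
      rintro x (rfl | hx) y (rfl | hy)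
      · rfl
      · exact (hcγ y hy).symm
      · exact hcγ x hx
      · exact hL.prop.mul_comm x hx y hy
    have hS : ∀ x ∈ insert e (L : Set D), ∀ δ, (decompose 𝒟 x δ : D) ∈ insert e (L : Set D) := by
      rintro x (rfl | hx) δ
      · by_cases h : γ = δ
        · subst h
          rw [decompose_of_mem_same 𝒟 hmem]
          exact Or.inl rfl
        · rw [decompose_of_mem_ne 𝒟 hmem h]
          exact Or.inr L.zero_mem
      · exact Or.inr (hL.prop.component_mem x hx δ)
    have hle := isGradedSubfield_centralizer_centralizer hD hcomm hS
    have hsub : insert e (L : Set D) ⊆ Subalgebra.centralizer (Subring.center D)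
        (Subalgebra.centralizer (Subring.center D) (insert e (L : Set D)) : Set D) :=
      Set.subset_centralizer_centralizer
    exact hL.le_of_ge hle (fun x hx => hsub (Or.inr hx)) (hsub (Or.inl rfl))
  rw [← sum_support_decompose 𝒟 c]
  exact sum_mem fun γ _ => hhom γ

theorem IsGradedSubfield.isUnit {L : Subalgebra (Subring.center D) D} (hL : IsGradedSubfield 𝒟 L)
    (l : L) (γ : Γ) (hl : (l : D) ∈ 𝒟 γ) (hne : l ≠ 0) : IsUnit l := by
  obtain ⟨y, hy, h⟩ := hL.exists_inv γ l l.2 hl (by simpa using hne)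
  exact ⟨⟨l, ⟨y, hy⟩, Subtype.ext h, Subtype.ext ((hL.mul_comm y hy l l.2).trans h)⟩, rfl⟩

theorem IsGradedDivisionRing.free_center (hD : IsGradedDivisionRing 𝒟) :
    Module.Free (Subring.center D) D := by
  obtain ⟨s, -, hli, hspan⟩ := exists_homogeneous_basis 𝒟 (Subring.center D).subtype
    (fun r x => rfl) (fun r γ => ⟨⟨_, component_mem_center 𝒟 r.2 γ⟩, rfl⟩)
    Subtype.val_injective (isUnit_of_mem_center hD) ⊤ (fun _ _ _ => trivial)
  exact Module.Free.of_basis (Module.Basis.mk hli (by simp [hspan]))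

/-- A graded subfield has a homogeneous basis over the centre. -/
theorem IsGradedSubfield.exists_basis (hD : IsGradedDivisionRing 𝒟)
    {L : Subalgebra (Subring.center D) D} (hL : IsGradedSubfield 𝒟 L) :
    ∃ (s : Set D) (b : Module.Basis s (Subring.center D) L) (ε : s → Γ),
      ∀ i, (b i : D) ∈ 𝒟 (ε i) := by
  obtain ⟨s, hs, hli, hspan⟩ := exists_homogeneous_basis 𝒟 (Subring.center D).subtype
    (fun r x => rfl) (fun r γ => ⟨⟨_, component_mem_center 𝒟 r.2 γ⟩, rfl⟩)
    Subtype.val_injective (isUnit_of_mem_center hD) (Subalgebra.toSubmodule L)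
    (fun x hx γ => hL.component_mem x hx γ)
  choose! ε hε using hs
  have hsL : ∀ i : s, (i : D) ∈ L := fun i => by
    rw [← Subalgebra.mem_toSubmodule, ← hspan]
    exact Submodule.subset_span i.2
  refine ⟨s, Module.Basis.mk (v := fun i : s => (⟨i, hsL i⟩ : L)) ?_ ?_, fun i => ε i, fun i => ?_⟩
  · exact LinearIndependent.of_comp L.val.toLinearMap hli
  · have hinj : Function.Injective L.val.toLinearMap := Subtype.val_injective
    rw [← Submodule.map_le_map_iff_of_injective hinj, Submodule.map_span, ← Set.range_comp]
    have : Set.range (L.val.toLinearMap ∘ fun i : s => (⟨i, hsL i⟩ : L)) = s := by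
      ext x; simp
    rw [this, hspan]
    rintro _ ⟨x, _, rfl⟩
    exact x.2
  · rw [Module.Basis.mk_apply]
    exact hε i i.2

/-- A graded division algebra has a finite homogeneous basis over every graded subfield. -/
theorem IsGradedSubfield.exists_finite_basis (hD : IsGradedDivisionAlgebra 𝒟)
    {L : Subalgebra (Subring.center D) D} (hL : IsGradedSubfield 𝒟 L) :
    ∃ (m : ℕ) (b : Module.Basis (Fin m) L D) (β : Fin m → Γ), ∀ i, b i ∈ 𝒟 (β i) := by
  obtain ⟨s, hs, hli, hspan⟩ := exists_homogeneous_basis 𝒟 (L.val : L →+* D)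
    (fun r x => rfl) (fun r γ => ⟨⟨_, hL.component_mem r r.2 γ⟩, rfl⟩)
    Subtype.val_injective hL.isUnit ⊤ (fun _ _ _ => trivial)
  choose! ε hε using hs
  have := hD.nontrivial
  have := hD.finite
  have : Module.Finite L D := Module.Finite.of_restrictScalars_finite (Subring.center D) L D
  let b : Module.Basis s L D := Module.Basis.mk hli (by simp [hspan])
  have hfin : Finite s := Module.Finite.finite_basis b
  refine ⟨_, b.reindex (Finite.equivFin s), fun i => ε ((Finite.equivFin s).symm i), fun i => ?_⟩
  rw [Module.Basis.reindex_apply, show b _ = _ from Module.Basis.mk_apply hli _ _]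
  exact hε _ (Subtype.coe_prop _)

theorem sandwich_injective (hD : IsGradedDivisionRing 𝒟)
    {L : Subalgebra (Subring.center D) D} (hL : IsGradedSubfield 𝒟 L) :
    Function.Injective (sandwich L) := by
  have := hD.nontrivial
  obtain ⟨s, e, ε, hε⟩ := hL.exists_basis hD
  rw [injective_iff_map_eq_zero]
  intro z hz
  obtain ⟨c, rfl⟩ := TensorProduct.eq_repr_basis_left e z
  have h := eq_zero_of_forall_sum_mul_mul_eq_zero 𝒟 hD.isUnit_of_mem
    (e := fun i => (e i : D)) (e.linearIndependent.map' L.val.toLinearMap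
      (LinearMap.ker_eq_bot.2 Subtype.val_injective)) hε c.support c (fun x => by
      have := LinearMap.congr_fun hz x
      simpa [Finsupp.sum, sandwich_tmul] using this)
  exact Finset.sum_eq_zero fun i hi => by
    rw [h i hi]
    exact TensorProduct.tmul_zero _ _

/-- Row `i` of `M z` holds the coordinates of the image of `b i`. This row convention undoes the
order reversal in `sandwich_mul`, and the shifts are the degrees of the basis. -/
theorem IsGradedMaximalSubfield.nonempty_gradedSplitting (hD : IsGradedDivisionAlgebra 𝒟)
    {L : Subalgebra (Subring.center D) D} (hL : IsGradedMaximalSubfield 𝒟 L) :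
    Nonempty (GradedSplitting 𝒟 L) := by
  have := hD.nontrivial
  obtain ⟨m, b, β, hβ⟩ := hL.prop.exists_finite_basis hD
  have hLc := hL.prop.mul_comm
  let M : L ⊗[Subring.center D] D → Matrix (Fin m) (Fin m) L :=
    fun z => Matrix.of fun i k => b.repr (sandwich L z (b i)) k
  have hrepr : ∀ z i, sandwich L z (b i) = ∑ k, (M z i k : D) * b k :=
    fun z i => (b.sum_repr (sandwich L z (b i))).symm
  have hbij : Function.Bijective M := by
    constructor
    · intro z w hzw
      refine sandwich_injective hD.toIsGradedDivisionRing hL.prop (LinearMap.ext fun x => ?_)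
      rw [← b.sum_repr x, map_sum, map_sum]
      refine Finset.sum_congr rfl fun i _ => ?_
      change sandwich L z ((b.repr x i : D) * b i) = sandwich L w ((b.repr x i : D) * b i)
      rw [sandwich_mul_left hLc, sandwich_mul_left hLc, hrepr, hrepr, hzw]
    · intro A
      choose t ht using fun i => exists_sandwich_eq_ite 𝒟 hD.isUnit_of_mem hL.prop.component_mem
        (fun c hc => hL.mem_of_commute hD.toIsGradedDivisionRing hc) b (fun i => ⟨_, hβ i⟩)
        b.linearIndependent Finset.univ i (Finset.mem_univ i)
      refine ⟨∑ i, t i * (1 ⊗ₜ ∑ k, A i k • b k), ?_⟩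
      ext i k
      have : sandwich L (∑ i, t i * (1 ⊗ₜ ∑ k, A i k • b k)) (b i) = ∑ k, A i k • b k := by
        rw [map_sum, LinearMap.sum_apply, Finset.sum_eq_single i]
        · rw [sandwich_mul_one_tmul, ht i i (Finset.mem_univ i), if_pos rfl, one_mul]
        · intro k _ hk
          rw [sandwich_mul_one_tmul, ht k i (Finset.mem_univ i), if_neg hk.symm, zero_mul]
        · simp
      simp only [M, Matrix.of_apply, this]
      rw [b.repr_sum_self]
  have hmul : ∀ z w, M (z * w) = M z * M w := by
    intro z w
    ext i k
    congr 1
    have : sandwich L (z * w) (b i) = ∑ k, (M z * M w) i k • b k := by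
      rw [sandwich_mul hLc, hrepr, map_sum]
      simp only [sandwich_mul_left hLc, hrepr, Matrix.mul_apply, Finset.sum_smul, Finset.mul_sum]
      rw [Finset.sum_comm]
      refine Finset.sum_congr rfl fun k _ => Finset.sum_congr rfl fun j _ => ?_
      rw [← mul_assoc]
      rfl
    change b.repr _ k = _
    rw [this, b.repr_sum_self]
  have hadd : ∀ z w, M (z + w) = M z + M w := fun z w => by
    ext i k
    simp [M]
  refine ⟨⟨m, β, RingEquiv.ofBijective (⟨⟨⟨M, ?_⟩, hmul⟩, ?_, hadd⟩ : _ →+* _) hbij, ?_, ?_⟩⟩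
  · ext i k
    simp [M, Algebra.TensorProduct.one_def, sandwich_tmul, Matrix.one_apply, Finsupp.single_apply]
  · ext i k
    simp [M]
  · intro l z
    ext i k
    change ((b.repr (sandwich L (l • z) (b i)) k : L) : D) =
      ((l • b.repr (sandwich L z (b i)) k : L) : D)
    rw [sandwich_smul]
    congr 1
    exact DFunLike.congr_fun (b.repr.map_smul l (sandwich L z (b i))) k
  · intro γ δ l x hl hx i k
    refine repr_mem_of_mem 𝒟 (L.val : L →+* D) (fun r x => rfl)
      (fun r γ => ⟨⟨_, hL.prop.component_mem r r.2 γ⟩, rfl⟩) b hβ ?_ k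
    rw [sandwich_tmul, show β i + (γ + δ) = γ + (β i + δ) by abel]
    exact SetLike.mul_mem_graded hl (SetLike.mul_mem_graded (hβ i) hx)

theorem mul_sub_mul_mem_gradedCommutatorSubmodule (x y : D) :
    x * y - y * x ∈ gradedCommutatorSubmodule 𝒟 := by
  classical
  rw [← sum_support_decompose 𝒟 x, ← sum_support_decompose 𝒟 y, Finset.sum_mul_sum,
    Finset.sum_mul_sum, Finset.sum_comm, ← Finset.sum_sub_distrib]
  refine sum_mem fun γ _ => ?_
  rw [← Finset.sum_sub_distrib]
  exact sum_mem fun δ _ => Submodule.subset_span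
    ⟨_, _, _, _, SetLike.coe_mem _, SetLike.coe_mem _, rfl⟩

theorem GradedSplitting.finrank_eq_and_reducedTrace (hD : IsGradedDivisionRing 𝒟)
    {L : Subalgebra (Subring.center D) D} (hL : IsGradedSubfield 𝒟 L) (S : GradedSplitting 𝒟 L) :
    Module.finrank (Subring.center D) D = S.size ^ 2 ∧
      ∀ a, ∃ d ∈ gradedCommutatorSubmodule 𝒟, S.reducedTrace a = S.size * a + d := by
  have := hD.nontrivial
  -- Extending the existing ring structure keeps the tensor product and matrix instances of `S`
  -- compatible.
  let _ : CommRing L :=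
    { (inferInstance : Ring L) with mul_comm := fun x y => Subtype.ext (hL.mul_comm x x.2 y y.2) }
  obtain ⟨s, e, -, -⟩ := hL.exists_basis hD
  have : Module.Free (Subring.center D) L := Module.Free.of_basis e
  let j : L ⊗[Subring.center D] D ≃ₐ[L] Matrix (Fin S.size) (Fin S.size) L :=
    AlgEquiv.ofRingEquiv (f := S.iso) fun l => by
      rw [Algebra.algebraMap_eq_smul_one, Algebra.algebraMap_eq_smul_one]
      exact (S.map_smul l 1).trans (by rw [map_one])
  refine ⟨?_, fun a => ?_⟩
  · have : Module.Free (Subring.center D) D := hD.free_center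
    rw [← Module.finrank_baseChange (R := L), j.toLinearEquiv.finrank_eq, Module.finrank_matrix]
    simp [sq]
  · obtain ⟨r, hr, d, hd, hrd⟩ := exists_trace_eq_mul_add j (gradedCommutatorSubmodule 𝒟)
      mul_sub_mul_mem_gradedCommutatorSubmodule a
    exact ⟨d, hd, (congrArg Subtype.val hr).symm.trans hrd⟩

end GradedDivision

theorem mainTheorem11 {Γ : Type*} [AddCommGroup Γ] [IsAddTorsionFree Γ] [DecidableEq Γ]
    {D : Type*} [Ring D] (𝒟 : Γ → AddSubgroup D) [GradedRing 𝒟]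
    (hD : IsGradedDivisionAlgebra 𝒟) (hF : IsNoetherianRing (Subring.center D)) :
    Module.finrank (Subring.center D) D = gradedIndex D ^ 2 ∧
    (∃ L : Subalgebra (Subring.center D) D, IsGradedMaximalSubfield 𝒟 L) ∧
    ∀ L : Subalgebra (Subring.center D) D, IsGradedMaximalSubfield 𝒟 L →
      Nonempty (GradedSplitting 𝒟 L) ∧
      ∀ (S : GradedSplitting 𝒟 L) (a : D),
        ∃ d ∈ gradedCommutatorSubmodule 𝒟, S.reducedTrace a = (gradedIndex D : D) * a + d := by
  have hD' := hD.toIsGradedDivisionRing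
  have hsize : ∀ {L : Subalgebra (Subring.center D) D}, IsGradedMaximalSubfield 𝒟 L →
      ∀ S : GradedSplitting 𝒟 L, gradedIndex D = S.size := fun hL S => by
    rw [gradedIndex, (S.finrank_eq_and_reducedTrace hD' hL.prop).1, Nat.sqrt_eq']
  obtain ⟨L₀, hL₀⟩ := exists_isGradedMaximalSubfield hD hF
  obtain ⟨S₀⟩ := hL₀.nonempty_gradedSplitting hD
  refine ⟨?_, ⟨L₀, hL₀⟩, fun L hL => ⟨hL.nonempty_gradedSplitting hD, fun S a => ?_⟩⟩
  · rw [hsize hL₀ S₀, (S₀.finrank_eq_and_reducedTrace hD' hL₀.prop).1]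
  · rw [hsize hL S]
    exact (S.finrank_eq_and_reducedTrace hD' hL.prop).2 a
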